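/- Let $B$ be a group acting (on the left) on a set $X$ with finitely many orbits, let $n\ge 0$ be an integer, and let $G=\mathbb{Z}^n\wr_X B=\big(\bigoplus_{x\in X}\mathbb{Z}^n\big)\rtimes B$ be the combinatorial wreath product, where $B$ acts on the direct sum by permuting the summands as it permutes $X$. For $x\in X$ let $B(x)=\{b\in B : bx=x\}$ be the stabiliser of $x$, and let $D=\bigcap_{x\in X}B(x)$ be the kernel of the action of $B$ on $X$. Call a group Hopfian if it is not isomorphic to any proper quotient of itself, equivalently, if each of its surjective endomorphisms is injective. Assume that 1. for every $d\in D$ with $d\neq 1$, the conjugacy class $\{gdg^{-1} : g\in B\}$ of $d$ in $B$ contains two elements that do not commute; 2. $B$ is Hopfian; 3. every automorphism of $B$ permutes the set of subgroups $\{B(x) : x\in X\}$; 4. for all $x,y\in X$ one has $[B(x):B(x)\cap B(y)]=[B(y):B(x)\cap B(y)]$, in the sense that either both indices are infinite, or both are finite and equal. Then $G$ is Hopfian. -/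

import Mathlib

/-- A group is Hopfian if it is not isomorphic to a proper quotient of itself, i.e. every
surjective endomorphism of the group is injective. -/
def IsHopfianGroup (G : Type*) [Group G] : Prop :=
  ∀ f : G →* G, Function.Surjective f → Function.Injective f

/-- The (left) action of `B` by automorphisms on the direct sum `⨁_{x ∈ X} A` of copies of `A`,
permuting the summands in the way in which `B` permutes `X`. The direct sum is written
multiplicatively. -/
noncomputable def wreathAction (A B X : Type*) [AddCommGroup A] [Group B] [MulAction B X] :
    B →* MulAut (Multiplicative (X →₀ A)) where
  toFun b := AddEquiv.toMultiplicative (Finsupp.domCongr (MulAction.toPerm b))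
  map_one' := by
    ext f x
    change Multiplicative.toAdd f ((1 : B)⁻¹ • x) = Multiplicative.toAdd f x
    simp
  map_mul' b c := by
    ext f x
    change Multiplicative.toAdd f ((b * c)⁻¹ • x) = Multiplicative.toAdd f (c⁻¹ • b⁻¹ • x)
    rw [mul_inv_rev, mul_smul]

theorem wreathAction_apply {A B X : Type*} [AddCommGroup A] [Group B] [MulAction B X]
    (b : B) (f : Multiplicative (X →₀ A)) (x : X) :
    Multiplicative.toAdd (wreathAction A B X b f) x = Multiplicative.toAdd f (b⁻¹ • x) :=
  rfl

/-- The combinatorial (permutational, restricted) wreath product `A ≀_X B` of an abelian group `A`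
and a group `B` acting on a set `X` on the left: the semidirect product of `⨁_{x ∈ X} A` and `B`,
where `B` permutes the summands. -/
abbrev CombWreathProduct (A X B : Type*) [AddCommGroup A] [Group B] [MulAction B X] : Type _ :=
  Multiplicative (X →₀ A) ⋊[wreathAction A B X] B

/-- The conjugacy class of `b` is non-abelian: it contains two elements that do not commute. -/
def HasNonabelianConjClass {B : Type*} [Group B] (b : B) : Prop :=
  ∃ u ∈ conjugatesOf b, ∃ v ∈ conjugatesOf b, ¬ Commute u v

/-- `Aut(B)` permutes the set `{stab_B(x) | x ∈ X}` of subgroups of `B`. -/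
def AutPermutesStabilizers (B X : Type*) [Group B] [MulAction B X] : Prop :=
  ∀ σ : MulAut B,
    Set.BijOn (fun H : Subgroup B => H.map (MulEquiv.toMonoidHom σ))
      (Set.range fun x : X => MulAction.stabilizer B x)
      (Set.range fun x : X => MulAction.stabilizer B x)

/-! ### Diagonal orbits on `X × X` and mass transport -/

section DiagonalOrbits

open MulAction

variable {B X : Type*} [Group B] [MulAction B X]

/-! A surjective endomorphism `φ` sends the base group onto an abelian normal subgroup. For `n > 0`,
commutation with conjugates by the base puts its projection to `B` inside `D`, and the conjugacy
class condition then makes that projection trivial (`map_inl_right_eq_one`). So `φ` induces a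
surjection of `B`, an automorphism `σ` by Hopficity, and it remains to see that the restriction `T`
of `φ` to the base, which is surjective and `σ`-semiequivariant, is injective.

Since `σ` permutes the stabilisers and there are finitely many orbits, a suitable power of `T`
composed with a permutation-type map is honestly equivariant
(`injective_of_surjective_of_semiequivariant`). Extending scalars leaves an equivariant surjection
`T` of a real permutation module.

The equality of indices is a unimodularity condition: it gives `T` an adjoint `S` and makes the sum
of diagonal coefficients over orbit representatives a trace (`orbitTrace_mul_comm`). For small `c >
0`, surjectivity of `T` makes the powers of `1 - cTS` tend to `0` on each basis vector, hence in
trace. The even powers of `1 - cST` have the same traces, so they too tend to `0`; but `1 - cST`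
fixes `ker T`, which must therefore vanish. -/

theorem ncard_orbit_stabilizer (x y : X) :
    (orbit (stabilizer B x) y).ncard = (stabilizer B y).relIndex (stabilizer B x) := by
  rw [← index_stabilizer, Subgroup.relIndex]
  congr 1

/-- The pairs `(q, y)` for which `(q.out, y)` lies in the diagonal orbit of `(x, y₀)` are counted
by the index of `stab x ∩ stab y₀` in `stab x`. -/
theorem ncard_fiber_diagonal_orbit (x y₀ : X) :
    {w : orbitRel.Quotient B X × X |
      (⟦(w.1.out, w.2)⟧ : orbitRel.Quotient B (X × X)) = ⟦(x, y₀)⟧}.ncard =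
      (stabilizer B y₀).relIndex (stabilizer B x) := by
  obtain ⟨b, hb⟩ : ∃ b : B, b • x = (⟦x⟧ : orbitRel.Quotient B X).out :=
    Quotient.mk_out (s := orbitRel B X) x
  have himage : {w : orbitRel.Quotient B X × X |
      (⟦(w.1.out, w.2)⟧ : orbitRel.Quotient B (X × X)) = ⟦(x, y₀)⟧} =
      (fun y : X => ((⟦x⟧ : orbitRel.Quotient B X), b • y)) '' orbit (stabilizer B x) y₀ := by
    ext ⟨q, y⟩
    simp only [Set.mem_ofPred_eq, Set.mem_image, Prod.mk.injEq]
    constructor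
    · intro h
      obtain ⟨c, hc⟩ : ∃ c : B, c • (x, y₀) = (q.out, y) := Quotient.exact h
      rw [Prod.smul_mk, Prod.mk.injEq] at hc
      have hq : (⟦x⟧ : orbitRel.Quotient B X) = q := by
        rw [← Quotient.out_eq q]
        exact (Quotient.sound (s := orbitRel B X) ⟨c, hc.1⟩).symm
      refine ⟨b⁻¹ • y, ⟨⟨b⁻¹ * c, ?_⟩, ?_⟩, hq, smul_inv_smul b y⟩
      · rw [mem_stabilizer_iff, mul_smul, hc.1, ← hq, ← hb, inv_smul_smul]
      · change (b⁻¹ * c) • y₀ = _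
        rw [mul_smul, hc.2]
    · rintro ⟨_, ⟨⟨c, hcx⟩, rfl⟩, rfl, rfl⟩
      refine Quotient.sound (s := orbitRel B (X × X)) ⟨b * c, ?_⟩
      change (b * c) • (x, y₀) = _
      rw [Prod.smul_mk, ← hb, mul_smul, mul_smul, mem_stabilizer_iff.mp hcx]
      rfl
  have hinj : Function.Injective
      (fun y : X => ((⟦x⟧ : orbitRel.Quotient B X), b • y)) := fun y z h =>
    MulAction.injective b (Prod.mk.inj h).2
  rw [himage, Set.ncard_image_of_injective _ hinj, ncard_orbit_stabilizer]

theorem ncard_fiber_diagonal_orbit_swap (x₀ y : X) :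
    {w : orbitRel.Quotient B X × X |
      (⟦(w.2, w.1.out)⟧ : orbitRel.Quotient B (X × X)) = ⟦(x₀, y)⟧}.ncard =
      (stabilizer B x₀).relIndex (stabilizer B y) := by
  rw [← ncard_fiber_diagonal_orbit]
  congr 1
  ext w
  have key (a b c d : X) :
      (⟦(a, b)⟧ : orbitRel.Quotient B (X × X)) = ⟦(c, d)⟧ →
      (⟦(b, a)⟧ : orbitRel.Quotient B (X × X)) = ⟦(d, c)⟧ := by
    intro h
    obtain ⟨g, hg⟩ : ∃ g : B, g • (c, d) = (a, b) := Quotient.exact h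
    refine Quotient.sound (s := orbitRel B (X × X)) ⟨g, ?_⟩
    exact congrArg Prod.swap hg
  exact ⟨key _ _ _ _, key _ _ _ _⟩

/-- The mass transport principle for a unimodular action. -/
theorem tsum_mass_transport
    (hindex : ∀ x y : X, (stabilizer B y).relIndex (stabilizer B x) =
      (stabilizer B x).relIndex (stabilizer B y))
    (f : X → X → ℝ) (hf : ∀ (b : B) (x y : X), f (b • x) (b • y) = f x y)
    (h₁ : Summable fun w : orbitRel.Quotient B X × X => f w.1.out w.2)
    (h₂ : Summable fun w : orbitRel.Quotient B X × X => f w.2 w.1.out) :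
    ∑' w : orbitRel.Quotient B X × X, f w.1.out w.2 =
      ∑' w : orbitRel.Quotient B X × X, f w.2 w.1.out := by
  let F : orbitRel.Quotient B (X × X) → ℝ := Quotient.lift (fun p => f p.1 p.2) (by
    rintro _ p ⟨b, rfl⟩
    exact hf b p.1 p.2)
  have key (g : orbitRel.Quotient B X × X → orbitRel.Quotient B (X × X))
      (hg : Summable fun w => F (g w)) :
      ∑' w, F (g w) = ∑' p, ({w | g w = p}.ncard : ℝ) * F p := by
    rw [← (Equiv.sigmaFiberEquiv g).tsum_eq, Summable.tsum_sigma]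
    · refine tsum_congr fun p => ?_
      calc ∑' w : {w // g w = p}, F (g w) = ∑' _ : {w // g w = p}, F p :=
            tsum_congr fun w => by rw [w.2]
        _ = _ := by
          -- On an infinite fibre `ncard` is `0`, and summability forces `F p = 0`, so the formula
          -- still holds.
          rw [tsum_const, nsmul_eq_mul]
          rfl
    · exact (Equiv.sigmaFiberEquiv g).summable_iff.mpr hg
  refine (key (fun w => ⟦(w.1.out, w.2)⟧) h₁).trans
    (Eq.trans ?_ (key (fun w => ⟦(w.2, w.1.out)⟧) h₂).symm)
  refine tsum_congr fun p => ?_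
  induction p using Quotient.inductionOn with
  | h p =>
    obtain ⟨x, y⟩ := p
    rw [ncard_fiber_diagonal_orbit, ncard_fiber_diagonal_orbit_swap, hindex]

end DiagonalOrbits

/-! ### Equivariant operators on `ℝ[X]` and their trace -/

section PermutationModule

open MulAction

variable {B X : Type*} [Group B] [MulAction B X]

/-- The permutation representation of `B` on finitely supported real functions on `X`. -/
noncomputable def permOperator (B X : Type*) [Group B] [MulAction B X] (b : B) :
    Module.End ℝ (X →₀ ℝ) :=
  Finsupp.lmapDomain ℝ ℝ (b • ·)

theorem permOperator_single (b : B) (x : X) (a : ℝ) :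
    permOperator B X b (Finsupp.single x a) = Finsupp.single (b • x) a :=
  Finsupp.mapDomain_single

theorem permOperator_apply_smul (b : B) (v : X →₀ ℝ) (x : X) :
    permOperator B X b v (b • x) = v x :=
  Finsupp.mapDomain_apply (MulAction.injective b) v x

/-- The ring of `B`-equivariant endomorphisms of the permutation module `ℝ[X]`. -/
noncomputable def equivariantEnd (B X : Type*) [Group B] [MulAction B X] :
    Subring (Module.End ℝ (X →₀ ℝ)) :=
  Subring.centralizer (Set.range (permOperator B X))

/-- Commuting with `B` amounts to matrix coefficients being constant on diagonal orbits, the form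
that mass transport needs. -/
theorem mem_equivariantEnd {T : Module.End ℝ (X →₀ ℝ)} :
    T ∈ equivariantEnd B X ↔
      ∀ (b : B) (x y : X), T (Finsupp.single (b • x) 1) (b • y) = T (Finsupp.single x 1) y := by
  rw [equivariantEnd, Subring.mem_centralizer_iff, Set.forall_mem_range]
  refine forall_congr' fun b => ⟨fun h x y => ?_, fun h => ?_⟩
  · rw [← permOperator_single, ← Module.End.mul_apply, ← h, Module.End.mul_apply,
      permOperator_apply_smul]
  · refine Finsupp.lhom_ext' fun x => LinearMap.ext_ring (Finsupp.ext fun y => ?_)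
    obtain ⟨y, rfl⟩ := MulAction.surjective b y
    simp only [LinearMap.comp_apply, Finsupp.lsingle_apply, Module.End.mul_apply]
    rw [permOperator_single, permOperator_apply_smul, h]

theorem apply_permOperator {T : Module.End ℝ (X →₀ ℝ)} (hT : T ∈ equivariantEnd B X)
    (b : B) (v : X →₀ ℝ) : T (permOperator B X b v) = permOperator B X b (T v) :=
  (LinearMap.congr_fun ((Subring.mem_centralizer_iff).mp hT _ ⟨b, rfl⟩) v).symm

theorem linearMap_apply_eq_sum (S : Module.End ℝ (X →₀ ℝ)) (v : X →₀ ℝ) (y : X) :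
    S v y = ∑ x ∈ v.support, v x * S (Finsupp.single x 1) y := by
  conv_lhs => rw [← Finsupp.sum_single v, Finsupp.sum, map_sum, Finsupp.finsetSum_apply]
  refine Finset.sum_congr rfl fun x _ => ?_
  rw [← mul_one (v x), ← smul_eq_mul, ← Finsupp.smul_single, map_smul, Finsupp.smul_apply]
  simp

/-- The sum of the diagonal matrix coefficients over representatives of the orbits. -/
noncomputable def orbitTrace [Fintype (orbitRel.Quotient B X)] (T : Module.End ℝ (X →₀ ℝ)) : ℝ :=
  ∑ q : orbitRel.Quotient B X, T (Finsupp.single q.out 1) q.out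

theorem orbitTrace_sub [Fintype (orbitRel.Quotient B X)] (S T : Module.End ℝ (X →₀ ℝ)) :
    orbitTrace (B := B) (S - T) = orbitTrace (B := B) S - orbitTrace (B := B) T := by
  simp [orbitTrace]

theorem finite_support_mul_coeff [Finite (orbitRel.Quotient B X)]
    (S T : Module.End ℝ (X →₀ ℝ)) :
    (Function.support fun w : orbitRel.Quotient B X × X =>
      T (Finsupp.single w.1.out 1) w.2 * S (Finsupp.single w.2 1) w.1.out).Finite := by
  refine Set.Finite.subset (s := ⋃ q : orbitRel.Quotient B X,
    Prod.mk q '' ((T (Finsupp.single q.out 1)).support : Set X))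
    (Set.finite_iUnion fun q => (Finset.finite_toSet _).image _) ?_
  rintro ⟨q, y⟩ h
  exact Set.mem_iUnion.mpr ⟨q, y, Finsupp.mem_support_iff.mpr (left_ne_zero_of_mul h), rfl⟩

theorem orbitTrace_mul [Fintype (orbitRel.Quotient B X)] (S T : Module.End ℝ (X →₀ ℝ)) :
    orbitTrace (B := B) (S * T) = ∑' w : orbitRel.Quotient B X × X,
      T (Finsupp.single w.1.out 1) w.2 * S (Finsupp.single w.2 1) w.1.out := by
  have hsum : Summable fun w : orbitRel.Quotient B X × X =>
      T (Finsupp.single w.1.out 1) w.2 * S (Finsupp.single w.2 1) w.1.out :=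
    summable_of_hasFiniteSupport (finite_support_mul_coeff S T)
  rw [hsum.tsum_prod, tsum_fintype, orbitTrace]
  refine Finset.sum_congr rfl fun q _ => ?_
  rw [Module.End.mul_apply, linearMap_apply_eq_sum, tsum_eq_sum]
  intro y hy
  rw [Finsupp.notMem_support_iff.mp hy, zero_mul]

/-- Both traces sum the invariant kernel `T_{yx} S_{xy}` over pairs, with the representative in the
first or the second place; mass transport exchanges the two. -/
theorem orbitTrace_mul_comm [Fintype (orbitRel.Quotient B X)]
    (hindex : ∀ x y : X, (stabilizer B y).relIndex (stabilizer B x) =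
      (stabilizer B x).relIndex (stabilizer B y))
    {S T : Module.End ℝ (X →₀ ℝ)} (hS : S ∈ equivariantEnd B X) (hT : T ∈ equivariantEnd B X) :
    orbitTrace (B := B) (S * T) = orbitTrace (B := B) (T * S) := by
  have h₁ : Summable fun w : orbitRel.Quotient B X × X =>
      T (Finsupp.single w.1.out 1) w.2 * S (Finsupp.single w.2 1) w.1.out :=
    summable_of_hasFiniteSupport (finite_support_mul_coeff S T)
  have h₂ : Summable fun w : orbitRel.Quotient B X × X =>
      S (Finsupp.single w.1.out 1) w.2 * T (Finsupp.single w.2 1) w.1.out :=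
    summable_of_hasFiniteSupport (finite_support_mul_coeff T S)
  rw [orbitTrace_mul, orbitTrace_mul]
  refine (tsum_mass_transport hindex
    (fun x y => T (Finsupp.single x 1) y * S (Finsupp.single y 1) x)
    (fun b x y => by rw [mem_equivariantEnd.mp hS, mem_equivariantEnd.mp hT]) h₁
    (h₂.congr fun w => mul_comm _ _)).trans (tsum_congr fun w => mul_comm _ _)

theorem semiconjBy_one_sub_mul {A : Type*} [Ring A] (a b : A) :
    SemiconjBy a (1 - b * a) (1 - a * b) := by
  rw [SemiconjBy, mul_sub, sub_mul, mul_one, one_mul, mul_assoc]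

/-- The element `w = ∑_{j<k} b (1 - ab)^j` serves both identities, so a single use of `tr (aw) = tr
(wa)` compares the traces of the powers. -/
theorem exists_one_sub_pow_eq {A : Type*} [Ring A] (M : Subring A) {a b : A} (ha : a ∈ M) (hb : b ∈ M) (k : ℕ) :
    ∃ w ∈ M, 1 - (1 - a * b) ^ k = a * w ∧ 1 - (1 - b * a) ^ k = w * a := by
  induction k with
  | zero => exact ⟨0, M.zero_mem, by simp, by simp⟩
  | succ k ih =>
    obtain ⟨w, hw, h₁, h₂⟩ := ih
    have hmem : w + b * (1 - a * b) ^ k ∈ M := M.add_mem hw (M.mul_mem hb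
      (M.pow_mem (M.sub_mem M.one_mem (M.mul_mem ha hb)) k))
    refine ⟨w + b * (1 - a * b) ^ k, hmem, ?_, ?_⟩
    · rw [mul_add, ← h₁, pow_succ', sub_mul, one_mul, mul_assoc a b]
      abel
    · have h : (1 - a * b) ^ k * a = a * (1 - b * a) ^ k :=
        ((semiconjBy_one_sub_mul a b).pow_right k).symm
      rw [add_mul, ← h₂, mul_assoc b, h, pow_succ', sub_mul, one_mul, mul_assoc b a]
      abel

theorem orbitTrace_one_sub_mul_pow [Fintype (orbitRel.Quotient B X)]
    (hindex : ∀ x y : X, (stabilizer B y).relIndex (stabilizer B x) =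
      (stabilizer B x).relIndex (stabilizer B y))
    {S T : Module.End ℝ (X →₀ ℝ)} (hS : S ∈ equivariantEnd B X) (hT : T ∈ equivariantEnd B X)
    (k : ℕ) :
    orbitTrace (B := B) ((1 - S * T) ^ k) = orbitTrace (B := B) ((1 - T * S) ^ k) := by
  obtain ⟨W, hW, h₁, h₂⟩ := exists_one_sub_pow_eq (equivariantEnd B X) hS hT k
  have h := orbitTrace_mul_comm hindex hS hW
  rw [← h₁, ← h₂, orbitTrace_sub, orbitTrace_sub] at h
  linarith

end PermutationModule

/-! ### Adjoints, norm bounds and injectivity over `ℝ` -/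

section Unimodular

open MulAction Filter Topology

variable {B X : Type*} [Group B] [MulAction B X]

theorem finite_orbit_stabilizer_of_coeff_ne_zero {T : Module.End ℝ (X →₀ ℝ)}
    (hT : T ∈ equivariantEnd B X) {x y : X} (h : T (Finsupp.single x 1) y ≠ 0) :
    (orbit (stabilizer B x) y).Finite := by
  refine (Finset.finite_toSet (T (Finsupp.single x 1)).support).subset ?_
  rintro _ ⟨⟨b, hb⟩, rfl⟩
  have := mem_equivariantEnd.mp hT b x y
  rw [mem_stabilizer_iff.mp hb] at this
  exact Finsupp.mem_support_iff.mpr (this.trans_ne h)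

/-- Columns are finite by definition, rows only by unimodularity. The nonzero coefficients meet
finitely many diagonal orbits, each cutting the row in an orbit of `stabilizer B y`, finite because
the opposite index is. -/
theorem finite_setOf_coeff_ne_zero [Finite (orbitRel.Quotient B X)]
    (hindex : ∀ x y : X, (stabilizer B y).relIndex (stabilizer B x) =
      (stabilizer B x).relIndex (stabilizer B y))
    {T : Module.End ℝ (X →₀ ℝ)} (hT : T ∈ equivariantEnd B X) (y : X) :
    {x | T (Finsupp.single x 1) y ≠ 0}.Finite := by
  refine Set.Finite.of_finite_fibers
    (fun x => (⟦(x, y)⟧ : orbitRel.Quotient B (X × X))) ?_ ?_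
  · refine Set.Finite.subset (s := ⋃ q : orbitRel.Quotient B X,
      (fun z => (⟦(q.out, z)⟧ : orbitRel.Quotient B (X × X))) ''
        ((T (Finsupp.single q.out 1)).support : Set X))
      (Set.finite_iUnion fun q => (Finset.finite_toSet _).image _) ?_
    rintro _ ⟨x, hx, rfl⟩
    obtain ⟨b, hb⟩ : ∃ b : B, b • x = (⟦x⟧ : orbitRel.Quotient B X).out :=
      Quotient.mk_out (s := orbitRel B X) x
    refine Set.mem_iUnion.mpr ⟨⟦x⟧, b • y, ?_, ?_⟩
    · rw [Finset.mem_coe, Finsupp.mem_support_iff, ← hb, mem_equivariantEnd.mp hT]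
      exact hx
    · exact Quotient.sound (s := orbitRel B (X × X)) ⟨b, by rw [← hb]; rfl⟩
  · rintro _ ⟨x, hx, rfl⟩
    have hfin : (orbit (stabilizer B y) x).Finite := by
      refine Set.finite_of_ncard_ne_zero ?_
      rw [ncard_orbit_stabilizer, hindex, ← ncard_orbit_stabilizer]
      exact (Set.ncard_pos (finite_orbit_stabilizer_of_coeff_ne_zero hT hx)).mpr
        (nonempty_orbit _) |>.ne'
    refine hfin.subset ?_
    rintro z ⟨-, hz⟩
    obtain ⟨b, hb⟩ : ∃ b : B, b • (x, y) = (z, y) := Quotient.exact hz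
    rw [Prod.smul_mk, Prod.mk.injEq] at hb
    exact ⟨⟨b, hb.2⟩, hb.1⟩

/-- The standard inner product on finitely supported functions. -/
noncomputable def finsuppDot (X : Type*) : LinearMap.BilinForm ℝ (X →₀ ℝ) :=
  Finsupp.linearCombination ℝ fun x => Finsupp.lapply x

theorem finsuppDot_apply (v w : X →₀ ℝ) : finsuppDot X v w = ∑ x ∈ v.support, v x * w x := by
  simp [finsuppDot, Finsupp.linearCombination_apply, Finsupp.sum, LinearMap.sum_apply]

theorem finsuppDot_single (x : X) (w : X →₀ ℝ) : finsuppDot X (Finsupp.single x 1) w = w x := by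
  simp [finsuppDot]

theorem finsuppDot_comm (v w : X →₀ ℝ) : finsuppDot X v w = finsuppDot X w v := by
  classical
  have h (v w : X →₀ ℝ) : finsuppDot X v w = ∑ x ∈ v.support ∩ w.support, v x * w x := by
    rw [finsuppDot_apply]
    refine (Finset.sum_subset Finset.inter_subset_left fun x hv hx => ?_).symm
    rw [Finsupp.notMem_support_iff.mp fun hw => hx (Finset.mem_inter.mpr ⟨hv, hw⟩), mul_zero]
  rw [h, h, Finset.inter_comm]
  exact Finset.sum_congr rfl fun x _ => mul_comm _ _

theorem finsuppDot_self_nonneg (v : X →₀ ℝ) : 0 ≤ finsuppDot X v v := by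
  rw [finsuppDot_apply]
  exact Finset.sum_nonneg fun x _ => mul_self_nonneg _

theorem finsuppDot_sq_le (v w : X →₀ ℝ) :
    finsuppDot X v w ^ 2 ≤ finsuppDot X v v * finsuppDot X w w :=
  LinearMap.BilinForm.apply_sq_le_of_symm _ finsuppDot_self_nonneg ⟨finsuppDot_comm⟩ v w

/-- The adjoint is the transposed matrix; finiteness of rows makes its values finitely supported. -/
theorem exists_adjoint [Finite (orbitRel.Quotient B X)]
    (hindex : ∀ x y : X, (stabilizer B y).relIndex (stabilizer B x) =
      (stabilizer B x).relIndex (stabilizer B y))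
    {T : Module.End ℝ (X →₀ ℝ)} (hT : T ∈ equivariantEnd B X) :
    ∃ S ∈ equivariantEnd B X,
      ∀ v w, finsuppDot X (T v) w = finsuppDot X v (S w) := by
  let S : Module.End ℝ (X →₀ ℝ) := Finsupp.linearCombination ℝ fun y =>
    Finsupp.ofSupportFinite (fun x => T (Finsupp.single x 1) y)
      (finite_setOf_coeff_ne_zero hindex hT y)
  have hS (x y : X) : S (Finsupp.single y 1) x = T (Finsupp.single x 1) y := by
    simp only [S, Finsupp.linearCombination_single, one_smul]
    rfl
  refine ⟨S, mem_equivariantEnd.mpr fun b x y => ?_, ?_⟩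
  · rw [hS, hS, mem_equivariantEnd.mp hT]
  · have h : (finsuppDot X).compl₁₂ T LinearMap.id = (finsuppDot X).compl₁₂ LinearMap.id S := by
      refine Finsupp.lhom_ext' fun x => LinearMap.ext_ring (Finsupp.lhom_ext' fun y =>
        LinearMap.ext_ring ?_)
      simp only [LinearMap.comp_apply, Finsupp.lsingle_apply, LinearMap.compl₁₂_apply,
        LinearMap.id_apply]
      rw [finsuppDot_comm, finsuppDot_single, finsuppDot_single, hS]
    intro v w
    exact LinearMap.congr_fun₂ h v w

/-- The absolute column sum depends only on the orbit of `x`; adding up one such sum per orbit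
bounds them all. -/
theorem exists_column_sum_bound [Finite (orbitRel.Quotient B X)]
    {T : Module.End ℝ (X →₀ ℝ)} (hT : T ∈ equivariantEnd B X) :
    ∃ C : ℝ, 0 ≤ C ∧ ∀ (x : X) (s : Finset X), ∑ y ∈ s, |T (Finsupp.single x 1) y| ≤ C := by
  classical
  have := Fintype.ofFinite (orbitRel.Quotient B X)
  let c (q : orbitRel.Quotient B X) : ℝ :=
    ∑ y ∈ (T (Finsupp.single q.out 1)).support, |T (Finsupp.single q.out 1) y|
  have hc (q) : 0 ≤ c q := Finset.sum_nonneg fun _ _ => abs_nonneg _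
  refine ⟨∑ q, c q, Finset.sum_nonneg fun q _ => hc q, fun x s => ?_⟩
  obtain ⟨b, hb⟩ : ∃ b : B, b • x = (⟦x⟧ : orbitRel.Quotient B X).out :=
    Quotient.mk_out (s := orbitRel B X) x
  refine le_trans ?_ (Finset.single_le_sum (fun q _ => hc q)
    (Finset.mem_univ (⟦x⟧ : orbitRel.Quotient B X)))
  calc ∑ y ∈ s, |T (Finsupp.single x 1) y|
      = ∑ y ∈ s.image (b • ·), |T (Finsupp.single (⟦x⟧ : orbitRel.Quotient B X).out 1) y| := by
        rw [Finset.sum_image fun _ _ _ _ h => MulAction.injective b h, ← hb]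
        exact Finset.sum_congr rfl fun y _ => by rw [mem_equivariantEnd.mp hT]
    _ ≤ ∑ y ∈ s.image (b • ·) ∪ (T (Finsupp.single (⟦x⟧ : orbitRel.Quotient B X).out 1)).support,
          |T (Finsupp.single (⟦x⟧ : orbitRel.Quotient B X).out 1) y| :=
        Finset.sum_le_sum_of_subset_of_nonneg Finset.subset_union_left fun _ _ _ => abs_nonneg _
    _ = c ⟦x⟧ := by
        refine (Finset.sum_subset Finset.subset_union_right fun y _ hy => ?_).symm
        rw [Finsupp.notMem_support_iff.mp hy, abs_zero]

/-- The Schur test. -/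
theorem finsuppDot_apply_self_le {S T : Module.End ℝ (X →₀ ℝ)}
    (hST : ∀ v w, finsuppDot X (T v) w = finsuppDot X v (S w)) {C R : ℝ} (hR : 0 ≤ R)
    (hC : ∀ (x : X) (s : Finset X), ∑ y ∈ s, |T (Finsupp.single x 1) y| ≤ C)
    (hS : ∀ (y : X) (s : Finset X), ∑ x ∈ s, |S (Finsupp.single y 1) x| ≤ R) (v : X →₀ ℝ) :
    finsuppDot X (T v) (T v) ≤ R * C * finsuppDot X v v := by
  have hS' (y : X) : ∑ x ∈ v.support, |T (Finsupp.single x 1) y| ≤ R := by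
    refine le_of_eq_of_le (Finset.sum_congr rfl fun x _ => ?_) (hS y v.support)
    have := hST (Finsupp.single x 1) (Finsupp.single y 1)
    rw [finsuppDot_comm, finsuppDot_single, finsuppDot_single] at this
    rw [this]
  -- Cauchy–Schwarz with weights `|T_{yx}|`.
  have hrow (y : X) :
      T v y * T v y ≤ R * ∑ x ∈ v.support, |T (Finsupp.single x 1) y| * (v x * v x) := by
    calc T v y * T v y = (∑ x ∈ v.support, v x * T (Finsupp.single x 1) y) ^ 2 := by
          rw [linearMap_apply_eq_sum, sq]
      _ ≤ (∑ x ∈ v.support, |T (Finsupp.single x 1) y|) *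
            ∑ x ∈ v.support, |T (Finsupp.single x 1) y| * (v x * v x) := by
          refine Finset.sum_sq_le_sum_mul_sum_of_sq_le_mul _ (fun _ _ => abs_nonneg _)
            (fun x _ => mul_nonneg (abs_nonneg _) (mul_self_nonneg _)) fun x _ => le_of_eq ?_
          rw [mul_pow, ← sq_abs (T _ y)]
          ring
      _ ≤ _ := mul_le_mul_of_nonneg_right (hS' y)
          (Finset.sum_nonneg fun x _ => mul_nonneg (abs_nonneg _) (mul_self_nonneg _))
  calc finsuppDot X (T v) (T v)
      ≤ ∑ y ∈ (T v).support,
          R * ∑ x ∈ v.support, |T (Finsupp.single x 1) y| * (v x * v x) := by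
        rw [finsuppDot_apply]
        exact Finset.sum_le_sum fun y _ => hrow y
    _ = R * ∑ x ∈ v.support,
          (∑ y ∈ (T v).support, |T (Finsupp.single x 1) y|) * (v x * v x) := by
        rw [← Finset.mul_sum, Finset.sum_comm]
        simp only [Finset.sum_mul]
    _ ≤ R * ∑ x ∈ v.support, C * (v x * v x) :=
        mul_le_mul_of_nonneg_left (Finset.sum_le_sum fun x _ =>
          mul_le_mul_of_nonneg_right (hC x _) (mul_self_nonneg _)) hR
    _ = R * C * finsuppDot X v v := by
        rw [← Finset.mul_sum, finsuppDot_apply, mul_assoc]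

theorem exists_bound_of_adjoint [Finite (orbitRel.Quotient B X)]
    {S T : Module.End ℝ (X →₀ ℝ)} (hS : S ∈ equivariantEnd B X) (hT : T ∈ equivariantEnd B X)
    (hST : ∀ v w, finsuppDot X (T v) w = finsuppDot X v (S w)) :
    ∃ c : ℝ, 0 < c ∧ (∀ v, c * finsuppDot X (S v) (S v) ≤ finsuppDot X v v) := by
  obtain ⟨C, hC, hTC⟩ := exists_column_sum_bound hT
  obtain ⟨R, hR, hSR⟩ := exists_column_sum_bound hS
  have hTS (v w) : finsuppDot X (S v) w = finsuppDot X v (T w) := by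
    rw [finsuppDot_comm, ← hST, finsuppDot_comm]
  -- The summand `1` keeps the constant invertible when `C * R = 0`.
  have h : 0 < C * R + 1 := by positivity
  refine ⟨(C * R + 1)⁻¹, by positivity, fun v => ?_⟩
  rw [inv_mul_le_iff₀ h]
  nlinarith [finsuppDot_apply_self_le hTS hC hSR hTC v, finsuppDot_self_nonneg v]

/-- If `S` is the adjoint of `T` and `c ‖S w‖² ≤ ‖w‖²`, then `(1 - c T S) ^ m (T z)` tends to `0`
in the `ℓ²`-norm. -/
theorem tendsto_one_sub_pow_apply {S T : Module.End ℝ (X →₀ ℝ)}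
    (hST : ∀ v w, finsuppDot X (T v) w = finsuppDot X v (S w)) {c : ℝ} (hc : 0 < c)
    (hS : ∀ w, c * finsuppDot X (S w) (S w) ≤ finsuppDot X w w) (z : X →₀ ℝ) :
    Tendsto (fun m : ℕ => finsuppDot X (((1 - T * (c • S)) ^ m) (T z))
      (((1 - T * (c • S)) ^ m) (T z))) atTop (𝓝 0) := by
  have hcomm (m : ℕ) : ((1 - T * (c • S)) ^ m) (T z) = T (((1 - (c • S) * T) ^ m) z) :=
    (LinearMap.congr_fun ((semiconjBy_one_sub_mul T (c • S)).pow_right m) z).symm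
  set b : ℕ → ℝ := fun m => finsuppDot X (((1 - (c • S) * T) ^ m) z) (((1 - (c • S) * T) ^ m) z)
    with hb
  -- Expanding `‖v - cSTv‖²` gives `‖v‖² - 2c‖Tv‖² + c²‖STv‖²`, and the bound on `S` absorbs the
  -- last term. Along the powers applied to `z` the right-hand sides telescope.
  have hstep (v : X →₀ ℝ) : c * finsuppDot X (T v) (T v) ≤
      finsuppDot X v v - finsuppDot X ((1 - (c • S) * T) v) ((1 - (c • S) * T) v) := by
    have h₁ : (1 - (c • S) * T) v = v - c • S (T v) := rfl
    have h₂ := hS (T v)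
    rw [h₁]
    simp only [map_sub, map_smul, LinearMap.sub_apply, LinearMap.smul_apply, smul_eq_mul]
    rw [finsuppDot_comm (S (T v)) v, ← hST]
    nlinarith
  have hb' (m : ℕ) : c * finsuppDot X (((1 - T * (c • S)) ^ m) (T z))
      (((1 - T * (c • S)) ^ m) (T z)) ≤ b m - b (m + 1) := by
    rw [hcomm, hb]
    simp only [pow_succ', Module.End.mul_apply (1 - (c • S) * T)]
    exact hstep _
  have hanti : Antitone b := antitone_nat_of_succ_le fun m => by
    have := mul_nonneg hc.le (finsuppDot_self_nonneg (((1 - T * (c • S)) ^ m) (T z)))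
    linarith [hb' m]
  have hlim := tendsto_atTop_ciInf hanti
    ⟨0, by rintro _ ⟨m, rfl⟩; exact finsuppDot_self_nonneg _⟩
  have hdiff : Tendsto (fun m => c⁻¹ * (b m - b (m + 1))) atTop (𝓝 0) := by
    simpa using (hlim.sub (hlim.comp (tendsto_add_atTop_nat 1))).const_mul c⁻¹
  refine squeeze_zero (fun m => finsuppDot_self_nonneg _) (fun m => ?_) hdiff
  rw [le_inv_mul_iff₀ hc]
  exact hb' m

theorem orbitTrace_pow_add_self [Fintype (orbitRel.Quotient B X)] {Q : Module.End ℝ (X →₀ ℝ)}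
    (hQ : ∀ v w, finsuppDot X (Q v) w = finsuppDot X v (Q w)) (m : ℕ) :
    orbitTrace (B := B) (Q ^ (m + m)) = ∑ q : orbitRel.Quotient B X,
      finsuppDot X ((Q ^ m) (Finsupp.single q.out 1)) ((Q ^ m) (Finsupp.single q.out 1)) := by
  have hpow (m : ℕ) : ∀ v w, finsuppDot X ((Q ^ m) v) w = finsuppDot X v ((Q ^ m) w) := by
    induction m with
    | zero => exact fun v w => rfl
    | succ m ih =>
      intro v w
      rw [pow_succ, Module.End.mul_apply, ih, hQ, ← Module.End.mul_apply, ← pow_succ', pow_succ]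
  refine Finset.sum_congr rfl fun q _ => ?_
  rw [hpow, finsuppDot_single, pow_add, Module.End.mul_apply]

/-- Permutation modules of unimodular actions with finitely many orbits are Hopfian over `ℝ`. -/
theorem injective_of_surjective_of_mem_equivariantEnd [Finite (orbitRel.Quotient B X)]
    (hindex : ∀ x y : X, (stabilizer B y).relIndex (stabilizer B x) =
      (stabilizer B x).relIndex (stabilizer B y))
    {T : Module.End ℝ (X →₀ ℝ)} (hT : T ∈ equivariantEnd B X) (hsurj : Function.Surjective T) :
    Function.Injective T := by
  have := Fintype.ofFinite (orbitRel.Quotient B X)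
  obtain ⟨S, hS, hST⟩ := exists_adjoint hindex hT
  have hTS (v w) : finsuppDot X (S v) w = finsuppDot X v (T w) := by
    rw [finsuppDot_comm, ← hST, finsuppDot_comm]
  obtain ⟨c, hc, hbound⟩ := exists_bound_of_adjoint hS hT hST
  have hcS : c • S ∈ equivariantEnd B X := mem_equivariantEnd.mpr fun b x y => by
    simp only [LinearMap.smul_apply, Finsupp.smul_apply, mem_equivariantEnd.mp hS]
  have hsymm₁ (v w) : finsuppDot X ((1 - T * (c • S)) v) w =
      finsuppDot X v ((1 - T * (c • S)) w) := by
    change finsuppDot X (v - T (c • S v)) w = finsuppDot X v (w - T (c • S w))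
    simp [hST, hTS]
  have hsymm₂ (v w) : finsuppDot X ((1 - (c • S) * T) v) w =
      finsuppDot X v ((1 - (c • S) * T) w) := by
    change finsuppDot X (v - c • S (T v)) w = finsuppDot X v (w - c • S (T w))
    simp [hST, hTS]
  have hsum : Tendsto (fun m : ℕ => ∑ q : orbitRel.Quotient B X,
      finsuppDot X (((1 - (c • S) * T) ^ m) (Finsupp.single q.out 1))
        (((1 - (c • S) * T) ^ m) (Finsupp.single q.out 1))) atTop (𝓝 0) := by
    have h : Tendsto (fun m : ℕ => ∑ q : orbitRel.Quotient B X,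
        finsuppDot X (((1 - T * (c • S)) ^ m) (Finsupp.single q.out 1))
          (((1 - T * (c • S)) ^ m) (Finsupp.single q.out 1))) atTop (𝓝 0) := by
      rw [← Finset.sum_const_zero (s := (Finset.univ : Finset (orbitRel.Quotient B X)))]
      refine tendsto_finsetSum _ fun q _ => ?_
      obtain ⟨z, hz⟩ := hsurj (Finsupp.single q.out 1)
      rw [← hz]
      exact tendsto_one_sub_pow_apply hST hc hbound z
    refine h.congr fun m => ?_
    rw [← orbitTrace_pow_add_self hsymm₁, ← orbitTrace_pow_add_self hsymm₂]
    exact orbitTrace_one_sub_mul_pow hindex hT hcS _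
  -- Self-adjointness gives `⟨v, e⟩ = ⟨v, (1 - cST)^m e⟩` for `v` in the kernel; Cauchy–Schwarz and
  -- `hsum` finish.
  have hker (v : X →₀ ℝ) (hv : T v = 0) (q : orbitRel.Quotient B X) : v q.out = 0 := by
    have hfix (m : ℕ) : ∀ w, finsuppDot X v (((1 - (c • S) * T) ^ m) w) = finsuppDot X v w := by
      induction m with
      | zero => exact fun w => rfl
      | succ m ih =>
        intro w
        rw [pow_succ', Module.End.mul_apply, ← hsymm₂]
        have : (1 - (c • S) * T) v = v := by
          change v - c • S (T v) = v
          rw [hv, map_zero, smul_zero, sub_zero]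
        rw [this, ih]
    have hle (m : ℕ) : v q.out ^ 2 ≤ finsuppDot X v v * ∑ q : orbitRel.Quotient B X,
        finsuppDot X (((1 - (c • S) * T) ^ m) (Finsupp.single q.out 1))
          (((1 - (c • S) * T) ^ m) (Finsupp.single q.out 1)) := by
      rw [← finsuppDot_single q.out v, finsuppDot_comm, ← hfix m]
      refine (finsuppDot_sq_le _ _).trans (mul_le_mul_of_nonneg_left ?_ (finsuppDot_self_nonneg v))
      exact Finset.single_le_sum (f := fun q : orbitRel.Quotient B X =>
        finsuppDot X (((1 - (c • S) * T) ^ m) (Finsupp.single q.out 1))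
          (((1 - (c • S) * T) ^ m) (Finsupp.single q.out 1)))
        (fun q _ => finsuppDot_self_nonneg _) (Finset.mem_univ q)
    have hle0 := ge_of_tendsto' (hsum.const_mul (finsuppDot X v v)) hle
    rw [mul_zero] at hle0
    exact pow_eq_zero_iff two_ne_zero |>.mp (le_antisymm hle0 (sq_nonneg _))
  -- The kernel is `B`-invariant, so vanishing at representatives suffices.
  refine (injective_iff_map_eq_zero T).mpr fun v hv => Finsupp.ext fun x => ?_
  obtain ⟨b, hb⟩ : ∃ b : B, b • x = (⟦x⟧ : orbitRel.Quotient B X).out :=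
    Quotient.mk_out (s := orbitRel B X) x
  rw [← permOperator_apply_smul b v x, hb]
  exact hker _ (by rw [apply_permOperator hT, hv, map_zero]) _

end Unimodular

/-! ### From `ℤⁿ`-valued functions to real ones -/

section IntegralPermutationModule

open MulAction

variable {B X : Type*} [Group B] [MulAction B X]

/-- The coordinates of a finitely supported function with values in `ℤⁿ`, as real numbers. -/
noncomputable def realCoordinates (n : ℕ) (X : Type*) :
    (X →₀ (Fin n → ℤ)) →+ ((Σ _ : Fin n, X) →₀ ℝ) where
  toFun f := Finsupp.ofSupportFinite (fun y => (f y.2 y.1 : ℝ)) (by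
    refine ((Set.finite_univ.prod f.support.finite_toSet).image
      fun p : Fin n × X => (⟨p.1, p.2⟩ : Σ _ : Fin n, X)).subset ?_
    rintro ⟨i, x⟩ h
    refine ⟨(i, x), ⟨Set.mem_univ i, Finsupp.mem_support_iff.mpr fun h0 => h ?_⟩, rfl⟩
    simp [h0])
  map_zero' := by
    ext y
    simp [Finsupp.ofSupportFinite_coe]
  map_add' f g := by
    ext y
    simp [Finsupp.ofSupportFinite_coe]

theorem realCoordinates_apply {n : ℕ} (f : X →₀ (Fin n → ℤ)) (y : Σ _ : Fin n, X) :
    realCoordinates n X f y = (f y.2 y.1 : ℝ) :=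
  rfl

theorem realCoordinates_injective (n : ℕ) : Function.Injective (realCoordinates n X) := by
  intro f g h
  ext x i
  exact Int.cast_injective (DFunLike.congr_fun h ⟨i, x⟩)

theorem realCoordinates_single {n : ℕ} (x : X) (i : Fin n) :
    realCoordinates n X (Finsupp.single x (Pi.single i 1)) = Finsupp.single ⟨i, x⟩ 1 := by
  classical
  ext ⟨j, y⟩
  rw [realCoordinates_apply, Finsupp.single_apply, Finsupp.single_apply]
  by_cases hx : x = y <;> by_cases hi : i = j
  · subst hx hi
    simp
  · simp [hx, hi, Ne.symm hi]
  · simp [hx]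
  · simp [hx]

theorem stabilizer_sigma_mk {ι : Type*} (i : ι) (x : X) :
    stabilizer B (⟨i, x⟩ : Σ _ : ι, X) = stabilizer B x := by
  ext b
  simp [mem_stabilizer_iff]

theorem finite_orbitRel_quotient_sigma {ι : Type*} [Finite ι]
    [Finite (orbitRel.Quotient B X)] : Finite (orbitRel.Quotient B (Σ _ : ι, X)) := by
  refine Finite.of_surjective (fun p : ι × orbitRel.Quotient B X =>
    (⟦⟨p.1, p.2.out⟩⟧ : orbitRel.Quotient B (Σ _ : ι, X))) fun q => ?_
  induction q using Quotient.inductionOn with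
  | h y =>
    obtain ⟨i, x⟩ := y
    obtain ⟨b, hb⟩ : ∃ b : B, b • x = (⟦x⟧ : orbitRel.Quotient B X).out :=
      Quotient.mk_out (s := orbitRel B X) x
    refine ⟨(i, ⟦x⟧), Quotient.sound (s := orbitRel B (Σ _ : ι, X)) ⟨b, ?_⟩⟩
    change b • (⟨i, x⟩ : Σ _ : ι, X) = _
    rw [Sigma.smul_mk, hb]

/-- Extend `T` to the real permutation module on `n` copies of `X`. Surjectivity survives since all
basis vectors are hit, and injectivity restricts to the integral points. -/
theorem injective_of_surjective_of_equivariant {n : ℕ} [Finite (orbitRel.Quotient B X)]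
    (hindex : ∀ x y : X, (stabilizer B y).relIndex (stabilizer B x) =
      (stabilizer B x).relIndex (stabilizer B y))
    (T : (X →₀ (Fin n → ℤ)) →+ (X →₀ (Fin n → ℤ)))
    (hT : ∀ (b : B) f, T (f.mapDomain (b • ·)) = (T f).mapDomain (b • ·))
    (hsurj : Function.Surjective T) : Function.Injective T := by
  have := finite_orbitRel_quotient_sigma (B := B) (X := X) (ι := Fin n)
  let R : Module.End ℝ ((Σ _ : Fin n, X) →₀ ℝ) := Finsupp.linearCombination ℝ fun y =>
    realCoordinates n X (T (Finsupp.single y.2 (Pi.single y.1 1)))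
  have hsingle (y : Σ _ : Fin n, X) : R (Finsupp.single y 1) =
      realCoordinates n X (T (Finsupp.single y.2 (Pi.single y.1 1))) := by
    simp [R]
  have hcomp : (realCoordinates n X).comp T = R.toAddMonoidHom.comp (realCoordinates n X) := by
    refine Finsupp.addHom_ext' fun x => AddMonoidHom.functions_ext' _ _ _ fun i =>
      AddMonoidHom.ext_int ?_
    change realCoordinates n X (T (Finsupp.single x (Pi.single i 1))) =
      R (realCoordinates n X (Finsupp.single x (Pi.single i 1)))
    rw [realCoordinates_single, hsingle]
  have hR : R ∈ equivariantEnd B (Σ _ : Fin n, X) := mem_equivariantEnd.mpr fun b y z => by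
    rw [hsingle, hsingle, realCoordinates_apply, realCoordinates_apply]
    change ((T (Finsupp.single (b • y.2) (Pi.single y.1 1)) (b • z.2) z.1 : ℤ) : ℝ) = _
    rw [← Finsupp.mapDomain_single (f := (b • ·)), hT,
      Finsupp.mapDomain_apply (MulAction.injective b)]
  have hRsurj : Function.Surjective R := by
    rw [← LinearMap.range_eq_top, eq_top_iff]
    intro v _
    rw [← Finsupp.sum_single v]
    refine Submodule.sum_mem _ fun y _ => ?_
    obtain ⟨f, hf⟩ := hsurj (Finsupp.single y.2 (Pi.single y.1 1))
    refine ⟨v y • realCoordinates n X f, ?_⟩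
    have h : realCoordinates n X (T f) = R (realCoordinates n X f) := DFunLike.congr_fun hcomp f
    rw [map_smul, ← h, hf, realCoordinates_single, Finsupp.smul_single, smul_eq_mul, mul_one]
  have hRinj : Function.Injective R := by
    refine injective_of_surjective_of_mem_equivariantEnd (fun x y => ?_) hR hRsurj
    obtain ⟨i, x⟩ := x
    obtain ⟨j, y⟩ := y
    rw [stabilizer_sigma_mk, stabilizer_sigma_mk, hindex]
  have h : Function.Injective (realCoordinates n X ∘ T) := by
    have : realCoordinates n X ∘ T = R ∘ realCoordinates n X := congrArg DFunLike.coe hcomp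
    rw [this]
    exact hRinj.comp (realCoordinates_injective n)
  exact h.of_comp

end IntegralPermutationModule

/-! ### Removing the twist by an automorphism -/

section TwistedEquivariance

open MulAction

variable {B X : Type*} [Group B] [MulAction B X]

/-- A power of `ρ` maps the stabilizer of each chosen representative of an orbit to the stabilizer
of some element of the same orbit. -/
theorem exists_pow_smul_eq_iff [Finite (orbitRel.Quotient B X)] (ρ : MulAut B)
    (hρ : ∀ x : X, ∃ y : X, ∀ b : B, ρ b • y = y ↔ b • x = x) :
    ∃ k : ℕ, k ≠ 0 ∧ ∀ q : orbitRel.Quotient B X, ∃ g : B, ∀ b : B,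
      (ρ ^ k) b • g • q.out = g • q.out ↔ b • q.out = q.out := by
  have hpow (j : ℕ) : ∀ x : X, ∃ y : X, ∀ b : B, (ρ ^ j) b • y = y ↔ b • x = x := by
    induction j with
    | zero => exact fun x => ⟨x, fun b => Iff.rfl⟩
    | succ j ih =>
      intro x
      obtain ⟨y, hy⟩ := ih x
      obtain ⟨z, hz⟩ := hρ y
      exact ⟨z, fun b => by rw [pow_succ', MulAut.mul_apply, hz, hy]⟩
  choose p hp using fun (j : ℕ) (q : orbitRel.Quotient B X) => hpow j q.out
  -- Pigeonhole on the finitely many self-maps of the set of orbits.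
  obtain ⟨i, j, hij, h⟩ : ∃ i j : ℕ, i < j ∧
      ∀ q, (⟦p i q⟧ : orbitRel.Quotient B X) = ⟦p j q⟧ := by
    obtain ⟨i, j, hij, h⟩ := Finite.exists_ne_map_eq_of_infinite
      fun (j : ℕ) (q : orbitRel.Quotient B X) => (⟦p j q⟧ : orbitRel.Quotient B X)
    rcases hij.lt_or_gt with hlt | hlt
    · exact ⟨i, j, hlt, congrFun h⟩
    · exact ⟨j, i, hlt, fun q => (congrFun h q).symm⟩
  refine ⟨j - i, (Nat.sub_pos_of_lt hij).ne', fun q => ?_⟩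
  obtain ⟨g, hg⟩ : ∃ g : B, g • p i q = p j q := Quotient.exact (h q).symm
  -- Applying `ρ ^ i` turns the condition at `q.out` into one at `p i q`, which `g` moves to `p j
  -- q`.
  refine ⟨(ρ ^ i)⁻¹ g, fun b => ?_⟩
  have hρb : (ρ ^ i) ((ρ ^ (j - i)) b) = (ρ ^ j) b := by
    rw [← MulAut.mul_apply, ← pow_add, Nat.add_sub_cancel' hij.le]
  rw [← hp j q b, ← hg, ← inv_smul_eq_iff, smul_smul, smul_smul, ← hp i q, map_mul, map_mul,
    map_inv, MulAut.apply_inv_self, hρb, mul_smul, mul_smul, inv_smul_eq_iff]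

/-- Send `b • q.out` to `ρ b • g q • q.out`: the stabiliser condition makes this well defined, and
each orbit maps onto itself. -/
theorem exists_surjective_semiequivariant (ρ : MulAut B)
    (hρ : ∀ q : orbitRel.Quotient B X, ∃ g : B, ∀ b : B,
      ρ b • g • q.out = g • q.out ↔ b • q.out = q.out) :
    ∃ s : X → X, Function.Surjective s ∧ ∀ (b : B) (x : X), s (b • x) = ρ b • s x := by
  choose g hg using hρ
  have hβ (x : X) : ∃ b : B, b • (⟦x⟧ : orbitRel.Quotient B X).out = x := by
    obtain ⟨b, hb⟩ : ∃ b : B, b • x = (⟦x⟧ : orbitRel.Quotient B X).out :=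
      Quotient.mk_out (s := orbitRel B X) x
    exact ⟨b⁻¹, inv_smul_eq_iff.mpr hb.symm⟩
  choose β hβ using hβ
  let s (x : X) : X := ρ (β x) • g ⟦x⟧ • (⟦x⟧ : orbitRel.Quotient B X).out
  have hs (b : B) (q : orbitRel.Quotient B X) : s (b • q.out) = ρ b • g q • q.out := by
    have hq : (⟦b • q.out⟧ : orbitRel.Quotient B X) = q :=
      (Quotient.sound (s := orbitRel B X) ⟨b, rfl⟩).trans q.out_eq
    have h := hβ (b • q.out)
    simp only [s]
    rw [hq] at h ⊢
    rw [eq_comm, ← inv_smul_eq_iff, smul_smul, ← map_inv, ← map_mul, hg, mul_smul,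
      inv_smul_eq_iff, h]
  refine ⟨s, fun y => ?_, fun b x => ?_⟩
  · refine ⟨ρ⁻¹ (β y * (g ⟦y⟧)⁻¹) • (⟦y⟧ : orbitRel.Quotient B X).out, ?_⟩
    rw [hs, MulAut.apply_inv_self, mul_smul, inv_smul_smul, hβ]
  · rw [← hβ x, smul_smul, hs, hs, map_mul, mul_smul]

/-- The iterate `T^[k]` is twisted by `σ ^ k`; pushing forward along a map `s` twisted by `σ⁻¹ ^ k`
cancels this and keeps surjectivity. -/
theorem injective_of_surjective_of_semiequivariant {n : ℕ} [Finite (orbitRel.Quotient B X)]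
    (hAut : AutPermutesStabilizers B X)
    (hindex : ∀ x y : X, (stabilizer B y).relIndex (stabilizer B x) =
      (stabilizer B x).relIndex (stabilizer B y))
    (σ : MulAut B) (T : (X →₀ (Fin n → ℤ)) →+ (X →₀ (Fin n → ℤ)))
    (hT : ∀ (b : B) f, T (f.mapDomain (b • ·)) = (T f).mapDomain (σ b • ·))
    (hsurj : Function.Surjective T) : Function.Injective T := by
  have hρ (x : X) : ∃ y : X, ∀ b : B, σ⁻¹ b • y = y ↔ b • x = x := by
    obtain ⟨y, hy⟩ := (hAut σ⁻¹).mapsTo ⟨x, rfl⟩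
    refine ⟨y, fun b => ?_⟩
    rw [← mem_stabilizer_iff, ← mem_stabilizer_iff]
    simp only at hy
    rw [hy]
    exact Subgroup.mem_map_iff_mem (f := (MulEquiv.toMonoidHom σ⁻¹)) (MulEquiv.injective σ⁻¹)
  obtain ⟨k, hk, hstab⟩ := exists_pow_smul_eq_iff σ⁻¹ hρ
  obtain ⟨s, hs, hsmul⟩ := exists_surjective_semiequivariant (σ⁻¹ ^ k) hstab
  have hiter (k : ℕ) (b : B) (f) :
      T^[k] (f.mapDomain (b • ·)) = (T^[k] f).mapDomain ((σ ^ k) b • ·) := by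
    induction k with
    | zero => rfl
    | succ k ih =>
      rw [Function.iterate_succ_apply', Function.iterate_succ_apply', ih, hT, pow_succ']
      rfl
  obtain ⟨Tk, hTk⟩ : ∃ Tk : (X →₀ (Fin n → ℤ)) →+ (X →₀ (Fin n → ℤ)), ⇑Tk = T^[k] :=
    ⟨⟨⟨T^[k], iterate_map_zero T k⟩, iterate_map_add T k⟩, rfl⟩
  have hinj : Function.Injective ((Finsupp.mapDomain.addMonoidHom s).comp Tk) := by
    refine injective_of_surjective_of_equivariant hindex _ (fun b f => ?_) ?_
    · change Finsupp.mapDomain s (Tk (f.mapDomain (b • ·))) =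
        Finsupp.mapDomain (b • ·) (Finsupp.mapDomain s (Tk f))
      rw [hTk, hiter, ← Finsupp.mapDomain_comp, ← Finsupp.mapDomain_comp]
      congr 1
      ext x
      simp only [Function.comp_apply]
      rw [hsmul, ← MulAut.mul_apply, inv_pow, inv_mul_cancel, MulAut.one_apply]
    · rw [AddMonoidHom.coe_comp, hTk]
      exact (Finsupp.mapDomain_surjective hs).comp (hsurj.iterate k)
  rw [AddMonoidHom.coe_comp, hTk] at hinj
  -- As `k ≠ 0`, the map `T` is the innermost factor of an injective composite.
  obtain ⟨k, rfl⟩ := Nat.exists_eq_succ_of_ne_zero hk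
  have := hinj.of_comp
  rw [Function.iterate_succ] at this
  exact this.of_comp

end TwistedEquivariance

/-! ### Surjective endomorphisms preserve the base group -/

section WreathProduct

open MulAction

theorem toAdd_wreathAction {A B X : Type*} [AddCommGroup A] [Group B] [MulAction B X]
    (b : B) (f : Multiplicative (X →₀ A)) :
    Multiplicative.toAdd (wreathAction A B X b f) =
      (Multiplicative.toAdd f).mapDomain (b • ·) :=
  Finsupp.equivMapDomain_eq_mapDomain _ _

variable {n : ℕ} {B X : Type*} [Group B] [MulAction B X]

/-- An element of `ℤⁿ ≀_X B` commuting with its conjugates by the base group acts trivially on `X`,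
unless `n = 0`. -/
theorem right_mem_ker_of_commute_conj {a : Fin n → ℤ} (ha : a ≠ 0)
    (u : CombWreathProduct (Fin n → ℤ) X B)
    (hu : ∀ f, Commute (SemidirectProduct.inl f * u * SemidirectProduct.inl f⁻¹) u) :
    u.right ∈ (MulAction.toPermHom B X).ker := by
  rw [MonoidHom.mem_ker]
  refine Equiv.ext fun x => ?_
  by_contra hx
  replace hx : u.right • x ≠ x := hx
  -- With `r = u.right`, commutation says `f - 2rf + r²f = 0` additively. For `f` equal to `a` at
  -- `x` and `0` elsewhere, the value at `r • x` is `-2a`, so `a = 0`.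
  have h := congrArg (fun v : CombWreathProduct (Fin n → ℤ) X B =>
    Multiplicative.toAdd v.left (u.right • x))
    (hu (Multiplicative.ofAdd (Finsupp.single x a))).eq
  have hx' : x ≠ u.right⁻¹ • x := fun h => hx (by nth_rw 1 [h]; rw [smul_inv_smul])
  simp only [SemidirectProduct.mul_left, SemidirectProduct.mul_right, SemidirectProduct.left_inl,
    SemidirectProduct.right_inl, map_one, MulAut.one_apply, one_mul, mul_one, toAdd_mul,
    Finsupp.add_apply, wreathAction_apply, inv_smul_smul, toAdd_inv, toAdd_ofAdd,
    Finsupp.neg_apply, Finsupp.single_eq_same, Finsupp.single_eq_of_ne hx,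
    Finsupp.single_eq_of_ne' hx'] at h
  refine ha (funext fun i => ?_)
  have hi := congrFun h i
  simp only [Pi.add_apply, Pi.neg_apply, Pi.zero_apply] at hi ⊢
  omega

theorem map_inl_right_eq_one
    (hD : ∀ d ∈ (MulAction.toPermHom B X).ker, d ≠ 1 → HasNonabelianConjClass d)
    (φ : CombWreathProduct (Fin n → ℤ) X B →* CombWreathProduct (Fin n → ℤ) X B)
    (hφ : Function.Surjective φ) (f : Multiplicative (X →₀ (Fin n → ℤ))) :
    (φ (SemidirectProduct.inl f)).right = 1 := by
  by_cases hn : ∃ a : Fin n → ℤ, a ≠ 0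
  · obtain ⟨a, ha⟩ := hn
    set u := φ (SemidirectProduct.inl f) with hu
    have hconj (g) : ∃ f', g * u * g⁻¹ = φ (SemidirectProduct.inl f') := by
      obtain ⟨h, rfl⟩ := hφ g
      refine ⟨(h * SemidirectProduct.inl f * h⁻¹).left, ?_⟩
      rw [hu, ← map_inv, ← map_mul, ← map_mul]
      congr 1
      ext <;> simp
    have hcomm (g h) : Commute (g * u * g⁻¹) (h * u * h⁻¹) := by
      obtain ⟨f₁, h₁⟩ := hconj g
      obtain ⟨f₂, h₂⟩ := hconj h
      rw [h₁, h₂]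
      exact ((Commute.all f₁ f₂).map SemidirectProduct.inl).map φ
    by_contra hne
    obtain ⟨v, hv, w, hw, hvw⟩ := hD u.right
      (right_mem_ker_of_commute_conj ha u fun f => by simpa using hcomm (SemidirectProduct.inl f) 1)
      hne
    obtain ⟨c, rfl⟩ := isConj_iff.mp hv
    obtain ⟨d, rfl⟩ := isConj_iff.mp hw
    refine hvw ?_
    simpa using (hcomm (SemidirectProduct.inr c) (SemidirectProduct.inr d)).map
      SemidirectProduct.rightHom
  · push Not at hn
    have hf : f = 1 := Multiplicative.toAdd.injective (Finsupp.ext fun x => hn _)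
    rw [hf, map_one, map_one, SemidirectProduct.one_right]

end WreathProduct

/-- `H.relIndex K` is the index `[K : H ∩ K]`, with value `0` exactly when this index is infinite;
so the last hypothesis says that the two indices are finite and equal, or both infinite. -/
theorem corollaryC (n : ℕ) {B X : Type*} [Group B] [MulAction B X]
    (hfin : Finite (MulAction.orbitRel.Quotient B X))
    (hD : ∀ d ∈ (MulAction.toPermHom B X).ker, d ≠ 1 → HasNonabelianConjClass d)
    (hB : IsHopfianGroup B)
    (hAut : AutPermutesStabilizers B X)
    (hindex : ∀ x y : X,
      (MulAction.stabilizer B y).relIndex (MulAction.stabilizer B x) =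
        (MulAction.stabilizer B x).relIndex (MulAction.stabilizer B y)) :
    IsHopfianGroup (CombWreathProduct (Fin n → ℤ) X B) := by
  intro φ hφ
  have hinl := map_inl_right_eq_one hD φ hφ
  let ψ : B →* B := SemidirectProduct.rightHom.comp (φ.comp SemidirectProduct.inr)
  have hright (g) : (φ g).right = ψ g.right := by
    rw [← SemidirectProduct.inl_left_mul_inr_right g, map_mul, SemidirectProduct.mul_right, hinl,
      one_mul]
    simp [ψ]
  have hψ : Function.Surjective ψ := fun b => by
    obtain ⟨g, hg⟩ := hφ (SemidirectProduct.inr b)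
    exact ⟨g.right, by rw [← hright, hg, SemidirectProduct.right_inr]⟩
  have hψinj := hB ψ hψ
  -- By injectivity of `ψ`, only base elements map into the base. This gives surjectivity of `T` and
  -- confines `ker φ` to the base.
  have hbase {g} (hg : (φ g).right = 1) : g = SemidirectProduct.inl g.left := by
    refine SemidirectProduct.ext rfl (hψinj ?_)
    rw [← hright, hg, SemidirectProduct.right_inl, map_one]
  let σ : MulAut B := MulEquiv.ofBijective ψ ⟨hψinj, hψ⟩
  let T : (X →₀ (Fin n → ℤ)) →+ (X →₀ (Fin n → ℤ)) :=
    { toFun f := Multiplicative.toAdd (φ (SemidirectProduct.inl (Multiplicative.ofAdd f))).left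
      map_zero' := by simp
      map_add' f g := by
        rw [ofAdd_add, map_mul, map_mul, SemidirectProduct.mul_left, hinl, map_one,
          MulAut.one_apply, toAdd_mul] }
  have hT (b : B) (f) : T (f.mapDomain (b • ·)) = (T f).mapDomain (σ b • ·) := by
    have h : φ (SemidirectProduct.inl (wreathAction (Fin n → ℤ) B X b (Multiplicative.ofAdd f))) *
        φ (SemidirectProduct.inr b) =
        φ (SemidirectProduct.inr b) * φ (SemidirectProduct.inl (Multiplicative.ofAdd f)) := by
      rw [← map_mul, ← map_mul, SemidirectProduct.inl_aut, map_inv, inv_mul_cancel_right]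
    have hleft := congrArg SemidirectProduct.left h
    rw [SemidirectProduct.mul_left, SemidirectProduct.mul_left, hinl, map_one, MulAut.one_apply,
      mul_comm, mul_right_inj, hright, SemidirectProduct.right_inr] at hleft
    have hadd := congrArg Multiplicative.toAdd hleft
    rw [toAdd_wreathAction] at hadd
    exact (congrArg T (toAdd_wreathAction b (Multiplicative.ofAdd f)).symm).trans hadd
  have hTsurj : Function.Surjective T := fun f => by
    obtain ⟨g, hg⟩ := hφ (SemidirectProduct.inl (Multiplicative.ofAdd f))
    refine ⟨Multiplicative.toAdd g.left, ?_⟩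
    change Multiplicative.toAdd (φ (SemidirectProduct.inl g.left)).left = f
    rw [← hbase (by rw [hg, SemidirectProduct.right_inl]), hg, SemidirectProduct.left_inl,
      toAdd_ofAdd]
  have hTinj := injective_of_surjective_of_semiequivariant hAut hindex σ T hT hTsurj
  refine (injective_iff_map_eq_one φ).mpr fun g hg => ?_
  have hg' := hbase (by rw [hg, SemidirectProduct.one_right])
  have hzero : T (Multiplicative.toAdd g.left) = 0 := by
    change Multiplicative.toAdd (φ (SemidirectProduct.inl g.left)).left = 0
    rw [← hg', hg, SemidirectProduct.one_left, toAdd_one]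
  have hone : g.left = 1 :=
    Multiplicative.toAdd.injective (hTinj (hzero.trans (map_zero T).symm))
  rw [hg', hone, map_one]
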